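/- Let $\mathbf c=(c_n)_{n\ge 1}$ be an oscillating sequence of complex numbers, that is, suppose that for some real $\lambda>1$ the limit $$\lim_{N\to\infty}\frac1N\sum_{n=1}^N|c_n|^\lambda$$ exists and is finite, and that $$\lim_{N\to\infty}\frac1N\sum_{n=1}^N c_n e^{2\pi i n t}=0\qquad\text{for every } 0\le t<1 .$$ Let $I=[a,b]\subset\mathbb R$ ($a\le b$) be a closed interval and let $f:I\to I$ be a continuous map whose topological entropy is zero. Then $\mathbf c$ is linearly disjoint from the flow $\{f^n\}_{n\ge 0}$ generated by $f$: for every continuous function $\varphi:I\to\mathbb C$ and every point $x\in I$, $$\lim_{N\to\infty}\frac1N\sum_{n=1}^N c_n\,\varphi(f^n x)=0 .$$ -/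

import Mathlib

open Filter Topology

/-- Oscillating sequence `c = (c₁, c₂, …)`; the value `c 0` plays no role. -/
def IsOscillating (c : ℕ → ℂ) : Prop :=
  (∃ lam : ℝ, 1 < lam ∧ ∃ K : ℝ,
    Tendsto (fun N : ℕ => (1 / (N : ℝ)) * ∑ n ∈ Finset.Icc 1 N, ‖c n‖ ^ lam) atTop (𝓝 K)) ∧
  ∀ t : ℝ, 0 ≤ t → t < 1 →
    Tendsto (fun N : ℕ => (1 / (N : ℂ)) *
      ∑ n ∈ Finset.Icc 1 N, c n * Complex.exp (2 * Real.pi * Complex.I * n * t)) atTop (𝓝 0)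

/-- The sequence `c` is linearly disjoint from the flow `{fⁿ}` generated by `f : X → X`. -/
def LinearlyDisjoint {X : Type*} [TopologicalSpace X] (c : ℕ → ℂ) (f : X → X) : Prop :=
  ∀ (φ : C(X, ℂ)) (x : X),
    Tendsto (fun N : ℕ => (1 / (N : ℂ)) * ∑ n ∈ Finset.Icc 1 N, c n * φ (f^[n] x)) atTop (𝓝 0)

/-- Topological entropy (Bowen–Dinaburg) of a self-map of a uniform space. -/
noncomputable def topologicalEntropy {X : Type*} [UniformSpace X] (f : X → X) : EReal :=
  Dynamics.coverEntropy f Set.univ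

/-! A horseshoe, that is, two disjoint compact intervals which some f^M maps over their common hull,
realises 2^n separated itineraries in time M * n and so forces positive entropy
(`coverEntropy_pos_of_horseshoe`). Zero entropy therefore excludes horseshoes, and this makes orbits
rigid: a non-convergent orbit eventually jumps from side to side of a fixed point
(`exists_alternating`). Applying this repeatedly to f^2 along even and odd times gives a dichotomy:
either some subsequence x (2^j * n + r) converges, or for every k the residue classes modulo 2^k
eventually have disjoint convex hulls (`exists_disjoint_hulls`).

In both cases φ(f^n x) is approximated in mean by periodic sequences. In the first the orbit is
asymptotically periodic. In the second, 2^k disjoint intervals inside [a, b] have total length at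
most b - a, so replacing the orbit by one late block of 2^k points, repeated periodically, moves it
by at most (b - a) / 2^k on average. Periodic sequences are finite sums of exponentials, hence
orthogonal in mean to c, and boundedness of the means of |c_n|^λ with λ > 1 carries this over to
such approximations (`IsOscillating.meanOrthogonal_of_approx`). -/

/-! ### Horseshoes and topological entropy -/

/-- No positive iterate of `f : ℝ → ℝ` maps each of two disjoint compact intervals over
the convex hull of their union. -/
def HasNoHorseshoe (f : ℝ → ℝ) : Prop :=
  ∀ (M : ℕ) (α β γ δ : ℝ), 0 < M → α ≤ β → β < γ → γ ≤ δ →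
    Set.Icc α δ ⊆ f^[M] '' Set.Icc α β → Set.Icc α δ ⊆ f^[M] '' Set.Icc γ δ → False

lemma HasNoHorseshoe.iterate {f : ℝ → ℝ} (h : HasNoHorseshoe f) {k : ℕ} (hk : 0 < k) :
    HasNoHorseshoe f^[k] := by
  intro M α β γ δ hM h1 h2 h3 h4 h5
  rw [← Function.iterate_mul] at h4 h5
  exact h (k * M) α β γ δ (Nat.mul_pos hk hM) h1 h2 h3 h4 h5

lemma iterate_conj_neg (f : ℝ → ℝ) (n : ℕ) (x : ℝ) :
    (fun t => -f (-t))^[n] x = -f^[n] (-x) := by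
  induction n generalizing x with
  | zero => simp
  | succ n ih => simp [Function.iterate_succ_apply, ih]

/-- Reflecting the line lets each one-sided statement about orbits be proved on one side only. -/
lemma HasNoHorseshoe.conj_neg {f : ℝ → ℝ} (h : HasNoHorseshoe f) :
    HasNoHorseshoe (fun t => -f (-t)) := by
  have key : ∀ (M : ℕ) (α β γ δ : ℝ),
      Set.Icc α δ ⊆ (fun t => -f (-t))^[M] '' Set.Icc β γ →
      Set.Icc (-δ) (-α) ⊆ f^[M] '' Set.Icc (-γ) (-β) := by
    intro M α β γ δ hs t ht
    obtain ⟨s, hs1, hs2⟩ := hs (show -t ∈ Set.Icc α δ from ⟨by linarith [ht.2], by linarith [ht.1]⟩)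
    rw [iterate_conj_neg] at hs2
    exact ⟨-s, ⟨by linarith [hs1.2], by linarith [hs1.1]⟩, by linarith⟩
  intro M α β γ δ hM h1 h2 h3 h4 h5
  exact h M (-δ) (-γ) (-β) (-α) hM (by linarith) (by linarith) (by linarith)
    (key _ _ _ _ _ h5) (key _ _ _ _ _ h4)

/-- If `f^[M]` maps each of the sets `A true`, `A false` over both, then every finite itinerary
is realised. -/
lemma exists_itinerary {X : Type*} {f : X → X} {M : ℕ} {A : Bool → Set X}
    (hne : ∀ i, (A i).Nonempty) (hcov : ∀ i j, A j ⊆ f^[M] '' A i) (n : ℕ) (s : ℕ → Bool) :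
    ∃ x ∈ A (s 0), ∀ i ≤ n, f^[M * i] x ∈ A (s i) := by
  induction n generalizing s with
  | zero =>
    obtain ⟨x, hx⟩ := hne (s 0)
    refine ⟨x, hx, fun i hi => ?_⟩
    obtain rfl : i = 0 := by omega
    simpa using hx
  | succ n ih =>
    obtain ⟨y, hy, hy'⟩ := ih (fun i => s (i + 1))
    obtain ⟨x, hx, rfl⟩ := hcov (s 0) _ hy
    refine ⟨x, hx, fun i hi => ?_⟩
    cases i with
    | zero => simpa using hx
    | succ i =>
      have := hy' i (by omega)
      rwa [← Function.iterate_add_apply, ← Nat.mul_succ] at this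

/-- Points with different itineraries of length n are 2r apart at some time M * i < M * n, so their
dynamical balls of radius r are disjoint. -/
lemma two_pow_le_netMaxcard {X : Type*} [PseudoMetricSpace X] {f : X → X} {M : ℕ} (hM : 0 < M)
    {A : Bool → Set X} {r : ℝ} (hr : 0 < r)
    (hne : ∀ i, (A i).Nonempty) (hcov : ∀ i j, A j ⊆ f^[M] '' A i)
    (hsep : ∀ i j, i ≠ j → ∀ x ∈ A i, ∀ y ∈ A j, 2 * r ≤ dist x y) (n : ℕ) :
    ((2 ^ n : ℕ) : ℕ∞) ≤
      Dynamics.netMaxcard f Set.univ {p : X × X | dist p.1 p.2 < r} (M * n) := by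
  classical
  have hw : ∀ s : Fin n → Bool, ∃ x, ∀ i : Fin n, f^[M * i] x ∈ A (s i) := by
    intro s
    obtain ⟨x, -, hx⟩ := exists_itinerary hne hcov n
      (fun i => if h : i < n then s ⟨i, h⟩ else true)
    refine ⟨x, fun i => ?_⟩
    simpa using hx i i.2.le
  choose x hx using hw
  have hdisj : ∀ s t : Fin n → Bool, s ≠ t → ∀ y : X,
      (∀ k < M * n, dist (f^[k] (x s)) (f^[k] y) < r) →
      (∀ k < M * n, dist (f^[k] (x t)) (f^[k] y) < r) → False := by
    intro s t hst y h1 h2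
    obtain ⟨i, hi⟩ := Function.ne_iff.1 hst
    have hlt : M * (i : ℕ) < M * n := Nat.mul_lt_mul_of_pos_left i.2 hM
    have h3 := hsep _ _ hi _ (hx s i) _ (hx t i)
    have h4 := dist_triangle_right (f^[M * i] (x s)) (f^[M * i] (x t)) (f^[M * i] y)
    linarith [h1 _ hlt, h2 _ hlt]
  have hnet : Dynamics.IsDynNetIn f Set.univ {p : X × X | dist p.1 p.2 < r} (M * n)
      (Finset.univ.image x : Finset X) := by
    refine ⟨Set.subset_univ _, ?_⟩
    intro u hu v hv huv
    simp only [Finset.coe_image, Finset.coe_univ, Set.image_univ, Set.mem_range] at hu hv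
    obtain ⟨s, rfl⟩ := hu
    obtain ⟨t, rfl⟩ := hv
    refine Set.disjoint_left.2 fun y hy1 hy2 => hdisj s t (fun h => huv (by rw [h])) y ?_ ?_
    · exact Dynamics.mem_ball_dynEntourage.1 hy1
    · exact Dynamics.mem_ball_dynEntourage.1 hy2
  have hinj : Function.Injective x := by
    intro s t hst
    by_contra hne
    exact hdisj s t hne (x s) (by simp [hr]) (by simp [hst, hr])
  have := hnet.card_le_netMaxcard
  rwa [Finset.card_image_of_injective _ hinj, Finset.card_univ, Fintype.card_fun,
    Fintype.card_bool, Fintype.card_fin] at this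

lemma coverEntropy_pos_of_horseshoe {X : Type*} [PseudoMetricSpace X] {f : X → X} {M : ℕ}
    (hM : 0 < M) {A : Bool → Set X} {r : ℝ} (hr : 0 < r)
    (hne : ∀ i, (A i).Nonempty) (hcov : ∀ i j, A j ⊆ f^[M] '' A i)
    (hsep : ∀ i j, i ≠ j → ∀ x ∈ A i, ∀ y ∈ A j, 2 * r ≤ dist x y) :
    0 < Dynamics.coverEntropy f Set.univ := by
  have h1 : ((Real.log 2 / M : ℝ) : EReal) ≤
      Dynamics.netEntropyEntourage f Set.univ {p : X × X | dist p.1 p.2 < r} := by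
    -- The entropy is a limsup, so growth along the multiples of M suffices.
    apply Frequently.le_expGrowthSup
    rw [frequently_atTop]
    intro k
    refine ⟨M * k, Nat.le_mul_of_pos_left k hM, ?_⟩
    have h2 := ENat.toENNReal_mono (two_pow_le_netMaxcard hM hr hne hcov hsep k)
    refine le_trans (le_of_eq ?_) h2
    have hM' : (M : ℝ) ≠ 0 := by positivity
    have h3 : ((Real.log 2 / M : ℝ) : EReal) * ((M * k : ℕ) : EReal)
        = ((k * Real.log 2 : ℝ) : EReal) := by
      rw [← EReal.coe_coe_eq_natCast, ← EReal.coe_mul]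
      congr 1
      push_cast
      field_simp
    rw [h3, EReal.exp_coe, Real.exp_nat_mul, Real.exp_log (by norm_num)]
    rw [ENNReal.ofReal_pow (by norm_num)]
    simp
  refine lt_of_lt_of_le ?_ (h1.trans (Dynamics.netEntropyEntourage_le_coverEntropy _ _
    (Metric.dist_mem_uniformity hr)))
  have : 0 < Real.log 2 / M := by positivity
  exact_mod_cast this

/-- The extension of a self-map of `[a, b]` to the line that is constant on either side. -/
noncomputable def extendToReal {a b : ℝ} (hab : a ≤ b) (f : Set.Icc a b → Set.Icc a b) : ℝ → ℝ :=
  fun t => f (Set.projIcc a b hab t)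

lemma extendToReal_iterate {a b : ℝ} (hab : a ≤ b) (f : Set.Icc a b → Set.Icc a b) (n : ℕ)
    (x : Set.Icc a b) : (extendToReal hab f)^[n] x = f^[n] x := by
  have h : Function.Semiconj (Subtype.val : Set.Icc a b → ℝ) f (extendToReal hab f) := by
    intro x
    simp [extendToReal]
  exact (h.iterate_right n x).symm

lemma hasNoHorseshoe_extendToReal {a b : ℝ} (hab : a ≤ b) (f : Set.Icc a b → Set.Icc a b)
    (hent : topologicalEntropy f = 0) : HasNoHorseshoe (extendToReal hab f) := by
  intro M α β γ δ hM h1 h2 h3 h4 h5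
  -- The hull lies in the image of a positive iterate of the extension, hence in [a, b], where the
  -- extension agrees with f.
  have hmem : ∀ t ∈ Set.Icc α δ, t ∈ Set.Icc a b := by
    intro t ht
    obtain ⟨s, -, rfl⟩ := h4 ht
    obtain ⟨m, rfl⟩ := Nat.exists_eq_succ_of_ne_zero hM.ne'
    rw [Function.iterate_succ_apply']
    exact Subtype.coe_prop _
  have hpos : 0 < Dynamics.coverEntropy f Set.univ := by
    refine coverEntropy_pos_of_horseshoe hM (r := (γ - β) / 2)
      (A := fun i => Subtype.val ⁻¹' (if i then Set.Icc α β else Set.Icc γ δ)) (by linarith) ?_ ?_ ?_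
    · rintro (_ | _)
      · exact ⟨⟨γ, hmem _ ⟨by linarith, h3⟩⟩, by simpa using h3⟩
      · exact ⟨⟨α, hmem _ ⟨le_rfl, by linarith⟩⟩, by simpa using h1⟩
    · intro i j t ht
      have ht' : (t : ℝ) ∈ Set.Icc α δ := by
        cases j <;> simp at ht <;> constructor <;> linarith [ht.1, ht.2]
      have key : ∀ B : Set ℝ, B ⊆ Set.Icc α δ → Set.Icc α δ ⊆ (extendToReal hab f)^[M] '' B →
          t ∈ f^[M] '' (Subtype.val ⁻¹' B) := by
        intro B hB hc
        obtain ⟨s, hs, hst⟩ := hc ht'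
        refine ⟨⟨s, hmem s (hB hs)⟩, hs, Subtype.ext ?_⟩
        rw [← extendToReal_iterate hab, hst]
      cases i
      · simpa using key _ (Set.Icc_subset_Icc_left (by linarith)) h5
      · simpa using key _ (Set.Icc_subset_Icc_right (by linarith)) h4
    · intro i j hij x hx y hy
      rw [Subtype.dist_eq, Real.dist_eq]
      have := le_abs_self ((x : ℝ) - y)
      have := neg_abs_le ((x : ℝ) - y)
      cases i <;> cases j <;> simp at hij hx hy <;> linarith [hx.1, hx.2, hy.1, hy.2]
  exact ne_of_gt hpos hent

/-! ### Orbits of interval maps without horseshoes -/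

lemma Icc_subset_image_Icc {g : ℝ → ℝ} (hg : Continuous g) {p q α δ : ℝ} (hpq : p ≤ q)
    (h : (g p ≤ α ∧ δ ≤ g q) ∨ (g q ≤ α ∧ δ ≤ g p)) :
    Set.Icc α δ ⊆ g '' Set.Icc p q := by
  rcases h with ⟨h1, h2⟩ | ⟨h1, h2⟩
  · exact (Set.Icc_subset_Icc h1 h2).trans (intermediate_value_Icc hpq hg.continuousOn)
  · exact (Set.Icc_subset_Icc h1 h2).trans (intermediate_value_Icc' hpq hg.continuousOn)

/-- A point on the unstable side of a fixed point never returns to the other side. -/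
lemma HasNoHorseshoe.lt_iterate {f : ℝ → ℝ} (h : HasNoHorseshoe f) (hf : Continuous f)
    {z v : ℝ} (hz : f z = z) (hzv : z < v) (hup : ∀ y, z < y → y ≤ v → y < f y) (m : ℕ) :
    z < f^[m] v := by
  by_contra hcon
  rw [not_lt] at hcon
  have hm : m ≠ 0 := by
    rintro rfl
    exact absurd hzv (not_lt.2 hcon)
  -- Pull v back along a decreasing backward orbit inside (z, v]. Then [z, y'] and [y, v] form a
  -- horseshoe for f^(m+1): on the first, z is fixed and y' reaches v; on the second, f^m sends y to
  -- v and v to a point ≤ z, after which f maps [z, v] over itself.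
  have hback : ∀ k : ℕ, ∃ y, z < y ∧ y ≤ v ∧ f^[k] y = v ∧
      ∃ y', z < y' ∧ y' < y ∧ f^[k + 1] y' = v := by
    have hpre : ∀ y, z < y → y ≤ v → ∃ y', z < y' ∧ y' < y ∧ f y' = y := by
      intro y h1 h2
      obtain ⟨y', hy', hfy'⟩ := intermediate_value_Ioo h1.le hf.continuousOn
        (show y ∈ Set.Ioo (f z) (f y) from ⟨by rwa [hz], hup y h1 h2⟩)
      exact ⟨y', hy'.1, hy'.2, hfy'⟩
    intro k
    induction k with
    | zero =>
      obtain ⟨y', h1, h2, h3⟩ := hpre v hzv le_rfl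
      exact ⟨v, hzv, le_rfl, rfl, y', h1, h2, h3⟩
    | succ k ih =>
      obtain ⟨y, h1, h2, -, y', h4, h5, h6⟩ := ih
      obtain ⟨y'', h7, h8, h9⟩ := hpre y' h4 (by linarith)
      exact ⟨y', h4, by linarith, h6, y'', h7, h8, by
        rw [Function.iterate_succ_apply, h9, h6]⟩
  obtain ⟨y, h1, h2, h3, y', h4, h5, h6⟩ := hback m
  have hfix : ∀ k, f^[k] z = z := fun k => Function.iterate_fixed hz k
  refine h (m + 1) z y' y v (Nat.succ_pos _) h4.le h5 h2 ?_ ?_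
  · exact Icc_subset_image_Icc (hf.iterate _) h4.le (Or.inl ⟨(hfix _).le, h6.ge⟩)
  · rw [Function.iterate_succ', Set.image_comp]
    refine (Icc_subset_image_Icc hf hzv.le (Or.inl ⟨hz.le, (hup v hzv le_rfl).le⟩)).trans
      (Set.image_mono ?_)
    exact Icc_subset_image_Icc (hf.iterate _) h2 (Or.inr ⟨hcon, h3.ge⟩)

lemma HasNoHorseshoe.iterate_lt {f : ℝ → ℝ} (h : HasNoHorseshoe f) (hf : Continuous f)
    {z v : ℝ} (hz : f z = z) (hvz : v < z) (hdown : ∀ y, y < z → v ≤ y → f y < y) (m : ℕ) :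
    f^[m] v < z := by
  have := h.conj_neg.lt_iterate (by fun_prop) (z := -z) (v := -v) (by simp [hz]) (by linarith)
    (fun y h1 h2 => by linarith [hdown (-y) (by linarith) (by linarith)]) m
  rw [iterate_conj_neg, neg_neg] at this
  linarith

/-- Take the largest point of [d, u] that f does not move up; points just to its right move up, so
in the limit it is fixed. -/
lemma exists_greatest_fixedPoint {f : ℝ → ℝ} (hf : Continuous f) {d u : ℝ} (hdu : d ≤ u)
    (hd : f d ≤ d) (hu : u < f u) :
    ∃ z, d ≤ z ∧ z < u ∧ f z = z ∧ ∀ y, z < y → y ≤ u → y < f y := by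
  have hc : IsCompact (Set.Icc d u ∩ {t | f t ≤ t}) :=
    isCompact_Icc.inter_right (isClosed_le hf continuous_id)
  obtain ⟨z, ⟨hz1, hz2⟩, hz3⟩ := hc.exists_isGreatest ⟨d, ⟨le_rfl, hdu⟩, hd⟩
  have hz2 : f z ≤ z := hz2
  have hzu : z < u := lt_of_le_of_ne hz1.2 (by rintro rfl; linarith)
  have hup : ∀ y, z < y → y ≤ u → y < f y := by
    intro y h1 h2
    by_contra hcon
    exact absurd (hz3 ⟨⟨by linarith [hz1.1], h2⟩, not_lt.1 hcon⟩) (not_le.2 h1)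
  refine ⟨z, hz1.1, hzu, le_antisymm hz2 ?_, hup⟩
  refine le_of_tendsto_of_tendsto (b := 𝓝[>] z) (f := fun y => y) (g := f)
    (tendsto_id.mono_left nhdsWithin_le_nhds) (hf.continuousAt.mono_left nhdsWithin_le_nhds) ?_
  filter_upwards [Ioc_mem_nhdsGT hzu] with y hy
  exact (hup y hy.1 hy.2).le

lemma exists_least_fixedPoint {f : ℝ → ℝ} (hf : Continuous f) {d u : ℝ} (hdu : d ≤ u)
    (hd : f d < d) (hu : u ≤ f u) :
    ∃ z, d < z ∧ z ≤ u ∧ f z = z ∧ ∀ y, y < z → d ≤ y → f y < y := by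
  obtain ⟨z, h1, h2, h3, h4⟩ := exists_greatest_fixedPoint (f := fun t => -f (-t))
    (by fun_prop) (d := -u) (u := -d) (by linarith) (by simpa using hu) (by simpa using hd)
  exact ⟨-z, by linarith, by linarith, by linarith, fun y h5 h6 => by
    have := h4 (-y) (by linarith) (by linarith)
    rw [neg_neg] at this
    linarith⟩

/-- Otherwise y moves down, and the least fixed point e above y repels to its left. Some v in [y, e)
then maps to w and next to z ≥ e, against `HasNoHorseshoe.iterate_lt`. -/
lemma HasNoHorseshoe.lt_apply {g : ℝ → ℝ} (h : HasNoHorseshoe g) (hg : Continuous g)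
    {w y z : ℝ} (hwy : w < y) (hyz : y < z) (hz : g z = z) (hw : g w = z) : w < g y := by
  by_contra hcon
  rw [not_lt] at hcon
  obtain ⟨e, h1, h2, h3, h4⟩ := exists_least_fixedPoint hg hyz.le (hcon.trans_lt hwy) hz.ge
  obtain ⟨v, hv, hgv⟩ := intermediate_value_Icc h1.le hg.continuousOn
    (show w ∈ Set.Icc (g y) (g e) from ⟨hcon, by linarith⟩)
  have hve : v < e := lt_of_le_of_ne hv.2 (by rintro rfl; linarith)
  have := h.iterate_lt hg h3 hve (fun t ht1 ht2 => h4 t ht1 (hv.1.trans ht2)) 2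
  simp only [Function.iterate_succ_apply, Function.iterate_zero, id, hgv, hw] at this
  linarith

section Orbit

variable {f : ℝ → ℝ} {x : ℕ → ℝ}

lemma orbit_add (hx : ∀ n, x (n + 1) = f (x n)) (n k : ℕ) : x (n + k) = f^[k] (x n) := by
  induction k with
  | zero => rfl
  | succ k ih => rw [← Nat.add_assoc, hx, ih, Function.iterate_succ_apply']

/-- If x j ≤ x i, a fixed point between them repels towards x i, so the orbit of x i could never
come down to x j. -/
lemma rising_lt_falling_of_lt (h : HasNoHorseshoe f) (hf : Continuous f)
    (hx : ∀ n, x (n + 1) = f (x n)) {i j : ℕ} (hij : i < j) (hi : x i < x (i + 1))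
    (hj : x (j + 1) < x j) : x i < x j := by
  by_contra hcon
  rw [not_lt] at hcon
  obtain ⟨z, h1, h2, h3, h4⟩ := exists_greatest_fixedPoint hf hcon (by rw [← hx]; exact hj.le)
    (by rwa [← hx])
  have := h.lt_iterate hf h3 h2 h4 (j - i)
  rw [← orbit_add hx, Nat.add_sub_cancel' hij.le] at this
  linarith

lemma rising_lt_falling (h : HasNoHorseshoe f) (hf : Continuous f)
    (hx : ∀ n, x (n + 1) = f (x n)) {i j : ℕ} (hi : x i < x (i + 1))
    (hj : x (j + 1) < x j) : x i < x j := by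
  rcases lt_trichotomy i j with hij | rfl | hij
  · exact rising_lt_falling_of_lt h hf hx hij hi hj
  · linarith
  · have := rising_lt_falling_of_lt (x := fun n => -x n) h.conj_neg (by fun_prop)
      (fun n => by simp [hx]) hij (by linarith) (by linarith)
    linarith

/-- A bounded, non-convergent orbit moves towards some fixed point from either side. -/
lemma exists_separating_fixedPoint (h : HasNoHorseshoe f) (hf : Continuous f)
    (hx : ∀ n, x (n + 1) = f (x n)) {a b : ℝ} (hb : ∀ n, x n ∈ Set.Icc a b)
    (hdiv : ¬∃ l, Tendsto x atTop (𝓝 l)) :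
    ∃ z, f z = z ∧ ∀ n, (x n < z ∧ x n < x (n + 1)) ∨ (z < x n ∧ x (n + 1) < x n) := by
  have hnofix : ∀ n, x (n + 1) ≠ x n := by
    intro n hn
    refine hdiv ⟨x n, tendsto_const_nhds.congr' ?_⟩
    filter_upwards [eventually_ge_atTop n] with k hk
    obtain ⟨m, rfl⟩ := Nat.exists_eq_add_of_le hk
    rw [orbit_add hx, Function.iterate_fixed]
    rw [← hx, hn]
  have hU : ∃ n, x n < x (n + 1) := by
    by_contra! hcon
    exact hdiv ⟨_, tendsto_atTop_ciInf (antitone_nat_of_succ_le hcon)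
      ⟨a, by rintro _ ⟨n, rfl⟩; exact (hb n).1⟩⟩
  have hD : ∃ n, x (n + 1) < x n := by
    by_contra! hcon
    exact hdiv ⟨_, tendsto_atTop_ciSup (monotone_nat_of_le_succ hcon)
      ⟨b, by rintro _ ⟨n, rfl⟩; exact (hb n).2⟩⟩
  obtain ⟨i, hi⟩ := hU
  obtain ⟨j, hj⟩ := hD
  set U := {y | ∃ n, x n = y ∧ x n < x (n + 1)} with hUdef
  set D := {y | ∃ n, x n = y ∧ x (n + 1) < x n} with hDdef
  have hUD : ∀ u ∈ U, ∀ d ∈ D, u ≤ d := by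
    rintro _ ⟨m, rfl, hm⟩ _ ⟨n, rfl, hn⟩
    exact (rising_lt_falling h hf hx hm hn).le
  have hUne : U.Nonempty := ⟨_, i, rfl, hi⟩
  have hDne : D.Nonempty := ⟨_, j, rfl, hj⟩
  have hUb : BddAbove U := ⟨x j, fun u hu => hUD u hu _ ⟨j, rfl, hj⟩⟩
  have hDb : BddBelow D := ⟨x i, fun d hd => hUD _ ⟨i, rfl, hi⟩ d hd⟩
  have hs : sSup U ≤ f (sSup U) := by
    have : closure U ⊆ {y | y ≤ f y} := closure_minimal
      (by rintro _ ⟨n, rfl, hn⟩; rw [hx] at hn; exact hn.le) (isClosed_le continuous_id hf)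
    exact this (csSup_mem_closure hUne hUb)
  have ht : f (sInf D) ≤ sInf D := by
    have : closure D ⊆ {y | f y ≤ y} := closure_minimal
      (by rintro _ ⟨n, rfl, hn⟩; rw [hx] at hn; exact hn.le) (isClosed_le hf continuous_id)
    exact this (csInf_mem_closure hDne hDb)
  have hst : sSup U ≤ sInf D := csSup_le hUne fun u hu => le_csInf hDne fun d hd => hUD u hu d hd
  -- The gap between rising and falling points has its left end not moved down and its right end not
  -- moved up.
  obtain ⟨z, hz, hz0⟩ := intermediate_value_Icc' (f := fun t => f t - t) hst (by fun_prop)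
    (show (0 : ℝ) ∈ Set.Icc _ _ from ⟨by linarith, by linarith⟩)
  have hz0 : f z = z := by linarith
  have hxz : ∀ n, x n ≠ z := fun n hn => hnofix n (by rw [hx, hn, hz0])
  refine ⟨z, hz0, fun n => ?_⟩
  rcases lt_or_gt_of_ne (hnofix n) with hn | hn
  · refine Or.inr ⟨lt_of_le_of_ne ?_ (hxz n).symm, hn⟩
    exact hz.2.trans (csInf_le hDb ⟨n, rfl, hn⟩)
  · refine Or.inl ⟨lt_of_le_of_ne ?_ (hxz n), hn⟩
    exact (le_csSup hUb ⟨n, rfl, hn⟩).trans hz.1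

/-- Once an orbit enters `(w, z)`, where `w` is a preimage of the separating fixed point `z`,
it stays above `w`. -/
lemma lt_orbit_of_preimage (h : HasNoHorseshoe f) (hf : Continuous f)
    (hx : ∀ n, x (n + 1) = f (x n)) {z w : ℝ} (hz : f z = z)
    (hsep : ∀ n, (x n < z ∧ x n < x (n + 1)) ∨ (z < x n ∧ x (n + 1) < x n))
    (hw : f w = z) (hwz : w < z) {n : ℕ} (hn : w < x n) (hn' : x n < z) {k : ℕ} (hk : n ≤ k) :
    w < x k := by
  have hff : ∀ y ∈ Set.Icc w z, w < f (f y) := by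
    intro y hy
    rcases eq_or_lt_of_le hy.1 with rfl | h1
    · rw [hw, hz]; exact hwz
    rcases eq_or_lt_of_le hy.2 with rfl | h2
    · rw [hz, hz]; exact hwz
    exact (h.iterate (k := 2) (by norm_num)).lt_apply (hf.iterate 2) h1 h2
      (by simp [hz]) (by simp [hw, hz])
  -- The invariant records that points right of z are images of points of [w, z]. Their successors
  -- lie in f^2 [w, z], hence above w; a successor still right of z lies between z and x k, so it is
  -- again such an image.
  have key : w < x k ∧ (x k < z ∨ (z < x k ∧ x k ∈ f '' Set.Icc w z)) := by
    induction k, hk using Nat.le_induction with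
    | base => exact ⟨hn, Or.inl hn'⟩
    | succ k hk ih =>
      obtain ⟨h1, h2 | ⟨h2, h3⟩⟩ := ih
      · rcases hsep k with ⟨-, h4⟩ | ⟨h4, -⟩
        · refine ⟨h1.trans h4, ?_⟩
          rcases hsep (k + 1) with ⟨h5, -⟩ | ⟨h5, -⟩
          · exact Or.inl h5
          · exact Or.inr ⟨h5, x k, ⟨h1.le, h2.le⟩, (hx k).symm⟩
        · linarith
      · rcases hsep k with ⟨h4, -⟩ | ⟨-, h4⟩
        · linarith
        obtain ⟨y, hy, hyx⟩ := h3
        refine ⟨by rw [hx, ← hyx]; exact hff y hy, ?_⟩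
        rcases hsep (k + 1) with ⟨h5, -⟩ | ⟨h5, -⟩
        · exact Or.inl h5
        · refine Or.inr ⟨h5, ?_⟩
          obtain ⟨t, ht, htx⟩ := intermediate_value_Icc' hy.2 hf.continuousOn
            (show x (k + 1) ∈ Set.Icc (f z) (f y) from
              ⟨by rw [hz]; exact h5.le, by rw [hyx]; exact h4.le⟩)
          exact ⟨t, ⟨hy.1.trans ht.1, ht.2⟩, htx⟩
  exact key.1

/-- The orbit climbs until it crosses z, since otherwise it would converge. Between the last two
points before the crossing, f passes through z; the second of them is trapped above that preimage by
`lt_orbit_of_preimage`. -/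
lemma exists_preimage_of_two_left (h : HasNoHorseshoe f) (hf : Continuous f)
    (hx : ∀ n, x (n + 1) = f (x n)) {b : ℝ} (hb : ∀ n, x n ≤ b)
    (hdiv : ¬∃ l, Tendsto x atTop (𝓝 l)) {z : ℝ} (hz : f z = z)
    (hsep : ∀ n, (x n < z ∧ x n < x (n + 1)) ∨ (z < x n ∧ x (n + 1) < x n))
    {n : ℕ} (hn : x n < z) (hn' : x (n + 1) < z) :
    ∃ w, x n < w ∧ w < z ∧ f w = z ∧ ∀ᶠ k in atTop, w < x k := by
  have hex : ∃ k, z < x (n + 2 + k) := by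
    by_contra! hcon
    refine hdiv ⟨_, (tendsto_add_atTop_iff_nat (n + 2)).1
      (tendsto_atTop_ciSup (monotone_nat_of_le_succ fun k => ?_)
        ⟨b, by rintro _ ⟨k, rfl⟩; exact hb _⟩)⟩
    rcases hsep (k + (n + 2)) with h1 | h1
    · rw [Nat.add_right_comm]; exact h1.2.le
    · have := hcon k
      rw [Nat.add_comm] at this
      linarith [h1.1]
  classical
  set k := Nat.find hex with hk
  have hk1 : z < x (n + 2 + k) := Nat.find_spec hex
  have hk2 : ∀ i ≤ k + 1, x (n + i) < z := by
    intro i hi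
    match i with
    | 0 => exact hn
    | 1 => exact hn'
    | i + 2 =>
      have := Nat.find_min hex (m := i) (by omega)
      rw [not_lt] at this
      rcases hsep (n + (i + 2)) with h1 | h1
      · exact h1.1
      · rw [show n + (i + 2) = n + 2 + i by ring] at h1
        linarith [h1.1]
  have hk3 : ∀ i ≤ k, x n ≤ x (n + i) := by
    intro i hi
    induction i with
    | zero => exact le_rfl
    | succ i ih =>
      rcases hsep (n + i) with h1 | h1
      · exact (ih (by omega)).trans h1.2.le
      · linarith [h1.1, hk2 i (by omega)]
  have hp : x (n + k) < z := hk2 k (by omega)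
  have hq : x (n + k + 1) < z := hk2 (k + 1) le_rfl
  have hpq : x (n + k) < x (n + k + 1) := by
    rcases hsep (n + k) with h1 | h1
    · exact h1.2
    · linarith [h1.1]
  obtain ⟨w, hw, hfw⟩ := intermediate_value_Ioo hpq.le hf.continuousOn
    (show z ∈ Set.Ioo (f (x (n + k))) (f (x (n + k + 1))) from
      ⟨by rwa [← hx], by rw [← hx, show n + k + 1 + 1 = n + 2 + k by ring]; exact hk1⟩)
  refine ⟨w, (hk3 k le_rfl).trans_lt hw.1, hw.2.trans hq, hfw, ?_⟩
  filter_upwards [eventually_ge_atTop (n + k + 1)] with m hm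
  exact lt_orbit_of_preimage h hf hx hz hsep hfw (hw.2.trans hq) hw.2 hq hm

/-- Eventually the orbit does not stay on the left of the separating fixed point for two
consecutive steps. -/
lemma eventually_left_to_right (h : HasNoHorseshoe f) (hf : Continuous f)
    (hx : ∀ n, x (n + 1) = f (x n)) {a b : ℝ} (hb : ∀ n, x n ∈ Set.Icc a b)
    (hdiv : ¬∃ l, Tendsto x atTop (𝓝 l)) {z : ℝ} (hz : f z = z)
    (hsep : ∀ n, (x n < z ∧ x n < x (n + 1)) ∨ (z < x n ∧ x (n + 1) < x n)) :
    ∀ᶠ n in atTop, x n < z → z < x (n + 1) := by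
  by_contra hcon
  have hfreq : ∃ᶠ n in atTop, x n < z ∧ x (n + 1) < z := by
    rw [Filter.not_eventually] at hcon
    refine hcon.mono fun n hn => ?_
    rw [Classical.not_imp] at hn
    refine ⟨hn.1, ?_⟩
    rcases hsep (n + 1) with h1 | h1
    · exact h1.1
    · exact absurd h1.1 hn.2
  set S := {y | ∃ n, x n = y ∧ x n < z ∧ x (n + 1) < z} with hS
  have hSb : BddAbove S := ⟨z, by rintro _ ⟨n, rfl, hn, -⟩; exact hn.le⟩
  have hSne : S.Nonempty := by
    obtain ⟨n, hn⟩ := hfreq.exists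
    exact ⟨_, n, rfl, hn⟩
  set ℓ := sSup S with hℓ
  have hle : ∀ n, x n < z → x (n + 1) < z → x n ≤ ℓ := fun n h1 h2 =>
    le_csSup hSb ⟨n, rfl, h1, h2⟩
  have hℓz : ℓ ≤ z := csSup_le hSne (by rintro _ ⟨n, rfl, hn, -⟩; exact hn.le)
  -- Preimages of z accumulate at ℓ from below and the orbit eventually exceeds each, so f ℓ = z and
  -- the lower limit of the orbit is at least ℓ.
  have hpre : ∀ c < ℓ, ∃ w, c < w ∧ w < ℓ ∧ f w = z ∧ ∀ᶠ k in atTop, w < x k := by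
    intro c hc
    obtain ⟨_, ⟨n, rfl, h1, h2⟩, h3⟩ := exists_lt_of_lt_csSup hSne hc
    obtain ⟨w, h4, -, h6, h7⟩ :=
      exists_preimage_of_two_left h hf hx (fun n => (hb n).2) hdiv hz hsep h1 h2
    obtain ⟨m, ⟨h8, h9⟩, h10⟩ := (hfreq.and_eventually h7).exists
    exact ⟨w, h3.trans h4, h10.trans_le (hle m h8 h9), h6, h7⟩
  have hev : ∀ c < ℓ, ∀ᶠ k in atTop, c < x k := by
    intro c hc
    obtain ⟨w, h1, -, -, h4⟩ := hpre c hc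
    exact h4.mono fun k hk => h1.trans hk
  have hfℓ : f ℓ = z := by
    have : ℓ ∈ closure {y | f y = z} := by
      rw [Metric.mem_closure_iff]
      intro ε hε
      obtain ⟨w, h1, h2, h3, -⟩ := hpre (ℓ - ε) (by linarith)
      exact ⟨w, h3, by rw [Real.dist_eq, abs_of_pos (by linarith)]; linarith⟩
    exact closure_minimal (fun _ h => h) (isClosed_eq hf continuous_const) this
  -- If ℓ = z the orbit converges to z: points slightly left of z map near z, and points right of z
  -- decrease.
  rcases eq_or_lt_of_le hℓz with heq | hlt
  · refine hdiv ⟨z, Metric.tendsto_atTop.2 fun ε hε => ?_⟩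
    obtain ⟨δ, hδ, hδf⟩ := Metric.continuousAt_iff.1 (hf.continuousAt (x := z)) ε hε
    obtain ⟨N, hN⟩ := eventually_atTop.1
      ((hev (z - δ) (by linarith)).and (hev (z - ε) (by linarith)))
    obtain ⟨n, hn, hnz, -⟩ := frequently_atTop.1 hfreq N
    have hub : ∀ k ≥ n, x k < z + ε := by
      intro k hk
      induction k, hk using Nat.le_induction with
      | base => linarith
      | succ k hk ih =>
        rcases hsep k with h1 | h1
        · have h2 := hδf (x := x k) (by
            rw [Real.dist_eq, abs_lt]
            exact ⟨by linarith [(hN k (hn.trans hk)).1], by linarith [h1.1]⟩)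
          rw [← hx, hz, Real.dist_eq, abs_lt] at h2
          linarith
        · linarith
    refine ⟨n, fun k hk => ?_⟩
    rw [Real.dist_eq, abs_lt]
    exact ⟨by linarith [(hN k (hn.trans hk)).2], by linarith [hub k hk]⟩
  -- If ℓ < z, a late double left step starts so near ℓ that the next point falls in (ℓ, z). As ℓ is
  -- a preimage of z, the orbit then stays above ℓ, so no later double left step is possible.
  · obtain ⟨δ, hδ, hδf⟩ := Metric.continuousAt_iff.1 (hf.continuousAt (x := ℓ)) (z - ℓ)
      (by linarith)
    obtain ⟨n, ⟨h1, h2⟩, h3⟩ := (hfreq.and_eventually (hev (ℓ - δ) (by linarith))).exists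
    have h4 := hδf (x := x n) (by
      rw [Real.dist_eq, abs_lt]
      exact ⟨by linarith, by linarith [hle n h1 h2]⟩)
    rw [← hx, hfℓ, Real.dist_eq, abs_lt] at h4
    obtain ⟨m, hm, h5, h6⟩ := frequently_atTop.1 hfreq (n + 1)
    have := lt_orbit_of_preimage h hf hx hz hsep hfℓ hlt (by linarith) h2 hm
    linarith [hle m h5 h6]

/-- A bounded, non-convergent orbit eventually alternates between the two sides of a point. -/
lemma exists_alternating (h : HasNoHorseshoe f) (hf : Continuous f)
    (hx : ∀ n, x (n + 1) = f (x n)) {a b : ℝ} (hb : ∀ n, x n ∈ Set.Icc a b)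
    (hdiv : ¬∃ l, Tendsto x atTop (𝓝 l)) :
    ∃ z N, ∀ n ≥ N, (x n < z ∧ z < x (n + 1)) ∨ (z < x n ∧ x (n + 1) < z) := by
  obtain ⟨z, hz, hsep⟩ := exists_separating_fixedPoint h hf hx hb hdiv
  have hleft := eventually_left_to_right h hf hx hb hdiv hz hsep
  have hright := eventually_left_to_right (x := fun n => -x n) (z := -z) (a := -b) (b := -a)
    h.conj_neg (by fun_prop) (fun n => by simp [hx])
    (fun n => ⟨by linarith [(hb n).2], by linarith [(hb n).1]⟩)
    (fun ⟨l, hl⟩ => hdiv ⟨-l, by simpa using hl.neg⟩) (by simp [hz])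
    (fun n => (hsep n).symm.imp (fun h => ⟨by linarith, by linarith⟩)
      (fun h => ⟨by linarith, by linarith⟩))
  obtain ⟨N, hN⟩ := eventually_atTop.1 (hleft.and hright)
  refine ⟨z, N, fun n hn => ?_⟩
  rcases hsep n with h1 | h1
  · exact Or.inl ⟨h1.1, (hN n hn).1 h1.1⟩
  · exact Or.inr ⟨h1.1, by linarith [(hN n hn).2 (by linarith)]⟩

/-- If no subsequence `n ↦ x (2 ^ j * n + r)` of the orbit converges, then far along the orbit the
residue classes modulo `2 ^ k` have disjoint convex hulls. -/
theorem exists_disjoint_hulls (k : ℕ) (h : HasNoHorseshoe f) (hf : Continuous f)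
    (hx : ∀ n, x (n + 1) = f (x n)) {a b : ℝ} (hb : ∀ n, x n ∈ Set.Icc a b)
    (hdiv : ∀ j r, ¬∃ l, Tendsto (fun n => x (2 ^ j * n + r)) atTop (𝓝 l)) :
    ∃ N, ∀ m ≥ N, ∀ n ≥ N, ∀ m' ≥ N, ∀ n' ≥ N, m % 2 ^ k = n % 2 ^ k → m' % 2 ^ k = n' % 2 ^ k →
      m % 2 ^ k ≠ m' % 2 ^ k → Disjoint (Set.uIcc (x m) (x n)) (Set.uIcc (x m') (x n')) := by
  induction k generalizing f x with
  | zero => exact ⟨0, fun m _ n _ m' _ n' _ _ _ h => absurd (by simp [Nat.mod_one]) h⟩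
  | succ k ih =>
    obtain ⟨z, N₀, hN₀⟩ := exists_alternating h hf hx hb (by simpa using hdiv 0 0)
    have hsub : ∀ s, ∃ N, ∀ m ≥ N, ∀ n ≥ N, ∀ m' ≥ N, ∀ n' ≥ N, m % 2 ^ k = n % 2 ^ k →
        m' % 2 ^ k = n' % 2 ^ k → m % 2 ^ k ≠ m' % 2 ^ k →
        Disjoint (Set.uIcc (x (2 * m + s)) (x (2 * n + s)))
          (Set.uIcc (x (2 * m' + s)) (x (2 * n' + s))) := by
      intro s
      refine ih (f := f^[2]) (x := fun n => x (2 * n + s)) (h.iterate (by norm_num)) (hf.iterate 2)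
        (fun n => ?_) (fun n => hb _) (fun j r ⟨l, hl⟩ => hdiv (j + 1) (2 * r + s) ⟨l, ?_⟩)
      · rw [← orbit_add hx]
        congr 1
        ring
      · refine hl.congr fun n => ?_
        congr 1
        ring
    obtain ⟨N₁, hN₁⟩ := hsub 0
    obtain ⟨N₂, hN₂⟩ := hsub 1
    have hside : ∀ n ≥ N₀, ∀ d, (x n < z → x (n + 2 * d) < z ∧ z < x (n + 2 * d + 1)) ∧
        (z < x n → z < x (n + 2 * d) ∧ x (n + 2 * d + 1) < z) := by
      intro n hn d
      induction d with
      | zero =>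
        rcases hN₀ n hn with h1 | h1
        · exact ⟨fun _ => h1, fun h2 => by linarith⟩
        · exact ⟨fun h2 => by linarith, fun _ => h1⟩
      | succ d ih =>
        have h1 := hN₀ (n + 2 * d) (by omega)
        have h2 := hN₀ (n + 2 * d + 1) (by omega)
        have h3 := hN₀ (n + 2 * d + 1 + 1) (by omega)
        rw [show n + 2 * (d + 1) = n + 2 * d + 1 + 1 by ring]
        constructor
        · intro h4
          have h5 := ih.1 h4
          rcases h2 with h2 | h2
          · linarith
          rcases h3 with h3 | h3
          · exact h3
          · linarith
        · intro h4
          have h5 := ih.2 h4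
          rcases h2 with h2 | h2
          · rcases h3 with h3 | h3
            · linarith
            · exact h3
          · linarith
    have hparity : ∀ m ≥ N₀, ∀ n ≥ N₀,
        (m % 2 = n % 2 → (x m < z ∧ x n < z) ∨ (z < x m ∧ z < x n)) ∧
        (m % 2 ≠ n % 2 → (x m < z ∧ z < x n) ∨ (z < x m ∧ x n < z)) := by
      have hord : ∀ m ≥ N₀, ∀ n ≥ m,
          (m % 2 = n % 2 → (x m < z ∧ x n < z) ∨ (z < x m ∧ z < x n)) ∧
          (m % 2 ≠ n % 2 → (x m < z ∧ z < x n) ∨ (z < x m ∧ x n < z)) := by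
        intro m hm n hn
        have h1 := hside m hm ((n - m) / 2)
        constructor
        · intro hmn
          rw [show m + 2 * ((n - m) / 2) = n by omega] at h1
          rcases hN₀ m hm with h2 | h2
          · exact Or.inl ⟨h2.1, (h1.1 h2.1).1⟩
          · exact Or.inr ⟨h2.1, (h1.2 h2.1).1⟩
        · intro hmn
          rw [show m + 2 * ((n - m) / 2) + 1 = n by omega] at h1
          rcases hN₀ m hm with h2 | h2
          · exact Or.inl ⟨h2.1, (h1.1 h2.1).2⟩
          · exact Or.inr ⟨h2.1, (h1.2 h2.1).2⟩
      intro m hm n hn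
      rcases le_total m n with hmn | hmn
      · exact hord m hm n hmn
      · have := hord n hn m hmn
        exact ⟨fun h => (this.1 h.symm).imp And.symm And.symm,
          fun h => ((this.2 (Ne.symm h)).symm).imp And.symm And.symm⟩
    refine ⟨max N₀ (2 * max N₁ N₂ + 1), fun m hm n hn m' hm' n' hn' hmn hmn' hne => ?_⟩
    -- A residue modulo 2^(k+1) is a parity together with the residue of the half modulo 2^k. The
    -- induction hypothesis for f^2 treats equal parities; z separates opposite ones.
    rw [pow_succ', Nat.mod_mul, Nat.mod_mul] at hmn hmn' hne
    by_cases hp : m % 2 = m' % 2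
    · rcases Nat.mod_two_eq_zero_or_one m with h0 | h0
      · have := hN₁ (m / 2) (by omega) (n / 2) (by omega) (m' / 2) (by omega) (n' / 2) (by omega)
          (by omega) (by omega) (by omega)
        rwa [show 2 * (m / 2) + 0 = m by omega, show 2 * (n / 2) + 0 = n by omega,
          show 2 * (m' / 2) + 0 = m' by omega, show 2 * (n' / 2) + 0 = n' by omega] at this
      · have := hN₂ (m / 2) (by omega) (n / 2) (by omega) (m' / 2) (by omega) (n' / 2) (by omega)
          (by omega) (by omega) (by omega)
        rwa [show 2 * (m / 2) + 1 = m by omega, show 2 * (n / 2) + 1 = n by omega,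
          show 2 * (m' / 2) + 1 = m' by omega, show 2 * (n' / 2) + 1 = n' by omega] at this
    · have h1 := (hparity m (by omega) n (by omega)).1 (by omega)
      have h2 := (hparity m' (by omega) n' (by omega)).1 (by omega)
      have h3 := (hparity m (by omega) m' (by omega)).2 hp
      rw [Set.disjoint_left]
      rintro t ht ht'
      rw [Set.mem_uIcc] at ht ht'
      grind

end Orbit

/-! ### Sequences orthogonal in mean to an oscillating sequence -/

/-- The averages of `c n * u n` tend to zero. -/
def MeanOrthogonal (c u : ℕ → ℂ) : Prop :=
  Tendsto (fun N : ℕ => (1 / (N : ℂ)) * ∑ n ∈ Finset.Icc 1 N, c n * u n) atTop (𝓝 0)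

lemma MeanOrthogonal.const_mul {c u : ℕ → ℂ} (h : MeanOrthogonal c u) (A : ℂ) :
    MeanOrthogonal c (fun n => A * u n) := by
  have := Tendsto.const_mul A h
  rw [mul_zero] at this
  refine this.congr fun N => ?_
  rw [Finset.mul_sum, Finset.mul_sum, Finset.mul_sum]
  exact Finset.sum_congr rfl fun n _ => by ring

lemma MeanOrthogonal.finset_sum {ι : Type*} {c : ℕ → ℂ} {u : ι → ℕ → ℂ} (s : Finset ι)
    (h : ∀ i ∈ s, MeanOrthogonal c (u i)) : MeanOrthogonal c (fun n => ∑ i ∈ s, u i n) := by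
  have := tendsto_finsetSum s h
  rw [Finset.sum_const_zero] at this
  refine this.congr fun N => ?_
  simp only [Finset.mul_sum]
  exact Finset.sum_comm

/-- A periodic sequence is orthogonal in mean to every oscillating sequence. -/
lemma IsOscillating.meanOrthogonal_periodic {c : ℕ → ℂ} (hc : IsOscillating c) {m : ℕ}
    (hm : 0 < m) (u : ℕ → ℂ) : MeanOrthogonal c (fun n => u (n % m)) := by
  have : NeZero m := ⟨hm.ne'⟩
  set Φ : ZMod m → ℂ := fun r => u r.val with hΦ
  -- Finite Fourier inversion, with frequencies j / m in [0, 1).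
  have hu : (fun n => u (n % m)) = fun n : ℕ => ∑ j : ZMod m, ((m : ℂ)⁻¹ * ZMod.dft Φ j) *
      Complex.exp (2 * Real.pi * Complex.I * n * ((j.val / m : ℝ) : ℂ)) := by
    funext n
    have h1 : u (n % m) = Φ (n : ZMod m) := by simp [hΦ, ZMod.val_natCast]
    have h2 : Φ = ZMod.dft.symm (ZMod.dft Φ) := by simp
    rw [h1]
    conv_lhs => rw [h2]
    rw [ZMod.invDFT_apply, smul_eq_mul, Finset.mul_sum]
    refine Finset.sum_congr rfl fun j _ => ?_
    have h3 : j * (n : ZMod m) = ((j.val * n : ℤ) : ZMod m) := by simp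
    rw [h3, ZMod.stdAddChar_coe, smul_eq_mul]
    rw [show 2 * (Real.pi : ℂ) * Complex.I * ((j.val * n : ℤ) : ℂ) / m
      = 2 * Real.pi * Complex.I * n * ((j.val / m : ℝ) : ℂ) by push_cast; ring]
    ring
  rw [hu]
  refine MeanOrthogonal.finset_sum _ fun j _ => MeanOrthogonal.const_mul ?_ _
  refine hc.2 _ (by positivity) ?_
  rw [div_lt_one (by positivity)]
  exact_mod_cast ZMod.val_lt j

/-- Truncation at height T: the excess is paid for by the moment of order λ, with a factor that
vanishes as T grows. -/
lemma le_add_rpow_mul_rpow {t T lam : ℝ} (ht : 0 ≤ t) (hT : 0 < T) (hlam : 1 < lam) :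
    t ≤ T + t ^ lam * T ^ (1 - lam) := by
  have h0 : 0 ≤ t ^ lam * T ^ (1 - lam) := by positivity
  rcases le_total t T with h | h
  · linarith
  have ht' : 0 < t := hT.trans_le h
  have h1 : t ^ (1 - lam) ≤ T ^ (1 - lam) := Real.rpow_le_rpow_of_nonpos hT h (by linarith)
  have h2 : t ^ lam * t ^ (1 - lam) = t := by
    rw [← Real.rpow_add ht']
    simp
  nlinarith [mul_le_mul_of_nonneg_left h1 (Real.rpow_nonneg ht lam)]

/-- Orthogonality in mean to an oscillating sequence is preserved by uniformly bounded
approximation in mean. -/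
lemma IsOscillating.meanOrthogonal_of_approx {c : ℕ → ℂ} (hc : IsOscillating c) {u : ℕ → ℂ} {B : ℝ}
    (happ : ∀ ε > 0, ∃ v, MeanOrthogonal c v ∧ (∀ n, ‖u n - v n‖ ≤ B) ∧
      ∀ᶠ N : ℕ in atTop, ∑ n ∈ Finset.Icc 1 N, ‖u n - v n‖ ≤ ε * N) :
    MeanOrthogonal c u := by
  obtain ⟨⟨lam, hlam, K, hK⟩, -⟩ := hc
  obtain ⟨C, hC⟩ := hK.bddAbove_range
  have hC' : ∀ N : ℕ, (1 / (N : ℝ)) * ∑ n ∈ Finset.Icc 1 N, ‖c n‖ ^ lam ≤ C :=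
    fun N => hC ⟨N, rfl⟩
  have hC0 : 0 ≤ C := by simpa using hC' 0
  have hB0 : 0 ≤ B := by
    obtain ⟨v, -, hv, -⟩ := happ 1 one_pos
    exact (norm_nonneg _).trans (hv 0)
  refine Metric.tendsto_atTop'.2 fun ε hε => ?_
  have hTlim : Tendsto (fun T : ℝ => B * C * T ^ (1 - lam)) atTop (𝓝 0) := by
    have := (tendsto_rpow_neg_atTop (y := lam - 1) (by linarith)).const_mul (B * C)
    simpa using this
  -- T is fixed before v is chosen, which is why B must not depend on the approximation; v is then
  -- taken with mean error ε / (3T).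
  obtain ⟨T, hT, hT0⟩ := ((hTlim.eventually (gt_mem_nhds (show 0 < ε / 3 by linarith))).and
    (eventually_gt_atTop 0)).exists
  obtain ⟨v, hv, hvB, hvN⟩ := happ (ε / 3 / T) (by positivity)
  have hv' := (Metric.tendsto_nhds.1 hv) (ε / 3) (by linarith)
  obtain ⟨N₀, hN₀⟩ := eventually_atTop.1 ((hvN.and hv').and (eventually_gt_atTop 0))
  refine ⟨N₀, fun N hN => ?_⟩
  obtain ⟨⟨h1, h2⟩, h3⟩ := hN₀ N hN.le
  have hNpos : (0 : ℝ) < N := by exact_mod_cast h3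
  rw [dist_zero_right] at h2 ⊢
  have hsplit : (1 / (N : ℂ)) * ∑ n ∈ Finset.Icc 1 N, c n * u n =
      (1 / (N : ℂ)) * ∑ n ∈ Finset.Icc 1 N, c n * v n +
      (1 / (N : ℂ)) * ∑ n ∈ Finset.Icc 1 N, c n * (u n - v n) := by
    rw [← mul_add, ← Finset.sum_add_distrib]
    congr 1
    exact Finset.sum_congr rfl fun n _ => by ring
  have hbound : ‖∑ n ∈ Finset.Icc 1 N, c n * (u n - v n)‖ ≤
      T * ∑ n ∈ Finset.Icc 1 N, ‖u n - v n‖ +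
        B * T ^ (1 - lam) * ∑ n ∈ Finset.Icc 1 N, ‖c n‖ ^ lam := by
    refine (norm_sum_le _ _).trans ?_
    rw [Finset.mul_sum, Finset.mul_sum, ← Finset.sum_add_distrib]
    refine Finset.sum_le_sum fun n _ => ?_
    rw [norm_mul]
    have h4 := le_add_rpow_mul_rpow (norm_nonneg (c n)) hT0 hlam
    have h5 : 0 ≤ ‖c n‖ ^ lam * T ^ (1 - lam) := by positivity
    calc ‖c n‖ * ‖u n - v n‖ ≤ (T + ‖c n‖ ^ lam * T ^ (1 - lam)) * ‖u n - v n‖ := by gcongr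
      _ = T * ‖u n - v n‖ + ‖c n‖ ^ lam * T ^ (1 - lam) * ‖u n - v n‖ := by ring
      _ ≤ T * ‖u n - v n‖ + ‖c n‖ ^ lam * T ^ (1 - lam) * B := by gcongr; exact hvB n
      _ = _ := by ring
  have hsum : ∑ n ∈ Finset.Icc 1 N, ‖c n‖ ^ lam ≤ C * N := by
    have := hC' N
    rwa [one_div, inv_mul_le_iff₀ hNpos, mul_comm] at this
  have hbound' : ‖∑ n ∈ Finset.Icc 1 N, c n * (u n - v n)‖ ≤ (2 * (ε / 3)) * N := by
    refine hbound.trans ?_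
    have h6 : T * ∑ n ∈ Finset.Icc 1 N, ‖u n - v n‖ ≤ T * (ε / 3 / T * N) := by gcongr
    have h7 : B * T ^ (1 - lam) * ∑ n ∈ Finset.Icc 1 N, ‖c n‖ ^ lam ≤
        B * T ^ (1 - lam) * (C * N) := by gcongr
    have h8 : T * (ε / 3 / T * N) = ε / 3 * N := by field_simp
    have h9 : B * T ^ (1 - lam) * (C * N) ≤ ε / 3 * N := by
      rw [show B * T ^ (1 - lam) * (C * N) = B * C * T ^ (1 - lam) * N by ring]
      gcongr
    linarith
  rw [hsplit]
  refine (norm_add_le _ _).trans_lt ?_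
  have h10 : ‖(1 / (N : ℂ)) * ∑ n ∈ Finset.Icc 1 N, c n * (u n - v n)‖ ≤ 2 * (ε / 3) := by
    rw [norm_mul, norm_div, norm_one, Complex.norm_natCast, one_div, inv_mul_le_iff₀ hNpos]
    linarith
  linarith

/-- A nonnegative bounded sequence whose sums over late blocks of length `m` are at most `S`
has upper mean at most `S / m`. -/
lemma eventually_sum_le_of_block_sum_le {e : ℕ → ℝ} {B S : ℝ} {m : ℕ} (hm : 0 < m)
    (he : ∀ n, 0 ≤ e n) (heB : ∀ n, e n ≤ B) {q₀ : ℕ}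
    (hblock : ∀ q ≥ q₀, ∑ r ∈ Finset.range m, e (m * q + r) ≤ S) {ε : ℝ} (hε : S / m < ε) :
    ∀ᶠ N : ℕ in atTop, ∑ n ∈ Finset.Icc 1 N, e n ≤ ε * N := by
  have hS : 0 ≤ S := (Finset.sum_nonneg fun r _ => he _).trans (hblock q₀ le_rfl)
  have hB : 0 ≤ B := (he 0).trans (heB 0)
  have hmpos : (0 : ℝ) < m := by exact_mod_cast hm
  -- The first q₀ blocks get the trivial bound m * B each, negligible after division by N.
  have hq : ∀ q : ℕ, ∑ n ∈ Finset.range (m * q), e n ≤ q₀ * (m * B) + q * S := by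
    intro q
    induction q with
    | zero => simp; positivity
    | succ q ih =>
      rw [Nat.mul_succ, Finset.sum_range_add]
      rcases lt_or_ge q q₀ with h | h
      · have h1 : ∑ n ∈ Finset.range (m * q), e n ≤ q * (m * B) := by
          refine (Finset.sum_le_card_nsmul _ _ B fun n _ => heB n).trans (le_of_eq ?_)
          rw [Finset.card_range, nsmul_eq_mul]; push_cast; ring
        have h2 : ∑ r ∈ Finset.range m, e (m * q + r) ≤ m * B := by
          refine (Finset.sum_le_card_nsmul _ _ B fun n _ => heB _).trans (le_of_eq ?_)
          rw [Finset.card_range, nsmul_eq_mul]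
        have h3 : ((q : ℝ) + 1) * (m * B) ≤ q₀ * (m * B) := by
          gcongr
          exact_mod_cast h
        have h4 : 0 ≤ ((q + 1 : ℕ) : ℝ) * S := by positivity
        linarith
      · have := hblock q h
        push_cast
        linarith
  have hlim : Tendsto (fun N : ℕ => (ε - S / m) * (N : ℝ)) atTop atTop :=
    (tendsto_natCast_atTop_atTop).const_mul_atTop (by linarith)
  filter_upwards [hlim.eventually_ge_atTop (q₀ * (m * B) + S)] with N hN
  have h1 : ∑ n ∈ Finset.Icc 1 N, e n ≤ ∑ n ∈ Finset.range (m * (N / m + 1)), e n := by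
    refine Finset.sum_le_sum_of_subset_of_nonneg ?_ fun n _ _ => he n
    intro n hn
    rw [Finset.mem_Icc] at hn
    rw [Finset.mem_range]
    rw [Nat.mul_succ]
    have := Nat.div_add_mod N m
    have := Nat.mod_lt N hm
    omega
  have h2 := hq (N / m + 1)
  have h3 : ((N / m + 1 : ℕ) : ℝ) * S ≤ (N / m + 1) * S := by
    push_cast
    gcongr
    exact Nat.cast_div_le
  have h4 : ((N : ℝ) / m + 1) * S = S / m * N + S := by ring
  linarith

/-! ### Zero entropy interval maps -/

lemma sum_abs_sub_le_of_disjoint_uIcc {ι : Type*} {s : Finset ι} {x y : ι → ℝ} {a b : ℝ}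
    (hab : a ≤ b) (hx : ∀ i ∈ s, x i ∈ Set.Icc a b) (hy : ∀ i ∈ s, y i ∈ Set.Icc a b)
    (hd : (s : Set ι).PairwiseDisjoint fun i => Set.uIcc (x i) (y i)) :
    ∑ i ∈ s, |y i - x i| ≤ b - a := by
  have h1 : MeasureTheory.volume (⋃ i ∈ s, Set.uIcc (x i) (y i)) ≤
      MeasureTheory.volume (Set.Icc a b) :=
    MeasureTheory.measure_mono (Set.iUnion₂_subset fun i hi =>
      Set.uIcc_subset_Icc (hx i hi) (hy i hi))
  rw [MeasureTheory.measure_biUnion_finset hd fun i _ => measurableSet_uIcc] at h1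
  simp only [Real.volume_interval, Real.volume_Icc] at h1
  rw [← ENNReal.ofReal_sum_of_nonneg fun i _ => abs_nonneg _] at h1
  exact (ENNReal.ofReal_le_ofReal_iff (by linarith)).1 h1

lemma norm_sub_le_two_mul_norm {X : Type*} [TopologicalSpace X] [CompactSpace X]
    (φ : C(X, ℂ)) (s t : X) : ‖φ s - φ t‖ ≤ 2 * ‖φ‖ := by
  linarith [norm_sub_le (φ s) (φ t), φ.norm_coe_le_norm s, φ.norm_coe_le_norm t]

/-- A bound linear in the distance, up to ε, turns control of the mean displacement into control of
the mean change of φ. -/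
lemma ContinuousMap.norm_sub_le_add_mul_dist {X : Type*} [PseudoMetricSpace X] [CompactSpace X]
    (φ : C(X, ℂ)) {ε : ℝ} (hε : 0 < ε) :
    ∃ C, 0 ≤ C ∧ ∀ s t, ‖φ s - φ t‖ ≤ ε + C * dist s t := by
  obtain ⟨δ, hδ, hφ⟩ := Metric.uniformContinuous_iff.1
    (CompactSpace.uniformContinuous_of_continuous φ.continuous) ε hε
  refine ⟨2 * ‖φ‖ / δ, by positivity, fun s t => ?_⟩
  rcases lt_or_ge (dist s t) δ with h | h
  · have h1 := hφ h
    rw [dist_eq_norm] at h1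
    have : 0 ≤ 2 * ‖φ‖ / δ * dist s t := by positivity
    linarith
  · have h1 := norm_sub_le_two_mul_norm φ s t
    have h2 : 2 * ‖φ‖ / δ * δ ≤ 2 * ‖φ‖ / δ * dist s t := by gcongr
    rw [div_mul_cancel₀ _ hδ.ne'] at h2
    linarith

/-- Observables along an asymptotically periodic orbit are orthogonal in mean to oscillating
sequences. -/
lemma IsOscillating.meanOrthogonal_of_tendsto {X : Type*} [TopologicalSpace X] [CompactSpace X]
    {c : ℕ → ℂ} (hc : IsOscillating c) {f : X → X} (hf : Continuous f) (φ : C(X, ℂ)) {x L : X}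
    {p r : ℕ} (hp : 0 < p) (hL : Tendsto (fun n => f^[p * n + r] x) atTop (𝓝 L)) :
    MeanOrthogonal c (fun n => φ (f^[n] x)) := by
  obtain ⟨L', hL'⟩ : ∃ L', Tendsto (fun n => f^[p * n] x) atTop (𝓝 L') := by
    -- Another p * r - r steps take time p * n + r to p * (n + r), a multiple of p.
    refine ⟨f^[p * r - r] L, (tendsto_add_atTop_iff_nat r).1 ?_⟩
    refine (((hf.iterate (p * r - r)).tendsto L).comp hL).congr fun n => ?_
    have : r ≤ p * r := Nat.le_mul_of_pos_left r hp
    rw [Function.comp_apply, ← Function.iterate_add_apply, Nat.mul_add,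
      show p * r - r + (p * n + r) = p * n + p * r by omega]
  refine hc.meanOrthogonal_of_approx (B := 2 * ‖φ‖) fun ε hε =>
    ⟨fun n => φ (f^[n % p] L'), hc.meanOrthogonal_periodic hp fun n => φ (f^[n] L'),
      fun n => norm_sub_le_two_mul_norm φ _ _, ?_⟩
  have hpos : (0 : ℝ) < p := by exact_mod_cast hp
  have hlim : Tendsto (fun q => ∑ s ∈ Finset.range p,
      ‖φ (f^[p * q + s] x) - φ (f^[(p * q + s) % p] L')‖) atTop (𝓝 0) := by
    rw [← Finset.sum_const_zero (s := Finset.range p)]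
    refine tendsto_finsetSum _ fun s hs => ?_
    rw [Finset.mem_range] at hs
    have h1 := ((φ.continuous.comp (hf.iterate s)).tendsto L').comp hL'
    have h2 := (tendsto_iff_norm_sub_tendsto_zero.1 h1)
    refine h2.congr fun q => ?_
    simp only [Function.comp_apply]
    rw [← Function.iterate_add_apply, Nat.add_comm s, Nat.mul_add_mod, Nat.mod_eq_of_lt hs]
  obtain ⟨q₀, hq₀⟩ := eventually_atTop.1
    (hlim.eventually (ge_mem_nhds (show 0 < ε / 2 * p by positivity)))
  refine eventually_sum_le_of_block_sum_le (S := ε / 2 * p) (B := 2 * ‖φ‖) hp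
    (fun n => norm_nonneg _) (fun n => norm_sub_le_two_mul_norm φ _ _) hq₀ ?_
  rw [mul_div_cancel_right₀ _ hpos.ne']
  linarith

theorem corollary1p2 (c : ℕ → ℂ) (hc : IsOscillating c) (a b : ℝ) (hab : a ≤ b)
    (f : Set.Icc a b → Set.Icc a b) (hf : Continuous f) (hent : topologicalEntropy f = 0) :
    LinearlyDisjoint c f := by
  intro φ x
  change MeanOrthogonal c (fun n => φ (f^[n] x))
  set ξ : ℕ → ℝ := fun n => f^[n] x with hξ
  by_cases hdiv : ∀ j r, ¬∃ l, Tendsto (fun n => ξ (2 ^ j * n + r)) atTop (𝓝 l)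
  swap
  · push Not at hdiv
    obtain ⟨j, r, l, hl⟩ := hdiv
    have hmem : l ∈ Set.Icc a b :=
      isClosed_Icc.mem_of_tendsto hl (Eventually.of_forall fun n => Subtype.coe_prop _)
    exact hc.meanOrthogonal_of_tendsto hf φ (L := ⟨l, hmem⟩) (p := 2 ^ j) (r := r)
      (by positivity) (tendsto_subtype_rng.2 hl)
  have hcont : Continuous (extendToReal hab f) :=
    continuous_subtype_val.comp (hf.comp continuous_projIcc)
  have horb : ∀ n, ξ (n + 1) = extendToReal hab f (ξ n) := by
    intro n
    simp [hξ, extendToReal, Function.iterate_succ_apply']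
  have hmem : ∀ n, ξ n ∈ Set.Icc a b := fun n => Subtype.coe_prop _
  refine hc.meanOrthogonal_of_approx (B := 2 * ‖φ‖) fun ε hε => ?_
  obtain ⟨C, hC, hφ⟩ := φ.norm_sub_le_add_mul_dist (half_pos hε)
  obtain ⟨k, hk⟩ : ∃ k : ℕ, C * (b - a) / (ε / 2) < 2 ^ k := pow_unbounded_of_one_lt _ one_lt_two
  obtain ⟨N, hN⟩ := exists_disjoint_hulls k (hasNoHorseshoe_extendToReal hab f hent) hcont horb
    hmem hdiv
  set m := 2 ^ k with hm
  have hm0 : 0 < m := by positivity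
  have hmpos : (0 : ℝ) < m := by exact_mod_cast hm0
  have hge : ∀ q ≥ N, ∀ r, m * q + r ≥ N := fun q hq r =>
    hq.trans ((Nat.le_mul_of_pos_left q hm0).trans (Nat.le_add_right _ _))
  -- The orbit is compared with its block starting at time m * N, repeated with period m. Since m =
  -- 2^k exceeds C * (b - a) / (ε / 2), the mean error is below ε.
  refine ⟨fun n => φ (f^[m * N + n % m] x),
    hc.meanOrthogonal_periodic hm0 fun n => φ (f^[m * N + n] x),
    fun n => norm_sub_le_two_mul_norm φ _ _, ?_⟩
  refine eventually_sum_le_of_block_sum_le (S := m * (ε / 2) + C * (b - a)) (B := 2 * ‖φ‖) hm0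
    (fun n => norm_nonneg _) (fun n => norm_sub_le_two_mul_norm φ _ _) (q₀ := N) (fun q hq => ?_) ?_
  · have h1 : ∑ r ∈ Finset.range m, |ξ (m * q + r) - ξ (m * N + r)| ≤ b - a := by
      refine sum_abs_sub_le_of_disjoint_uIcc hab (fun _ _ => hmem _) (fun _ _ => hmem _) ?_
      intro r hr s hs hrs
      rw [Finset.coe_range, Set.mem_Iio] at hr hs
      exact hN _ (hge N le_rfl r) _ (hge q hq r) _ (hge N le_rfl s) _ (hge q hq s)
        (by simp) (by simp)
        (by simpa [Nat.mul_add_mod, Nat.mod_eq_of_lt hr, Nat.mod_eq_of_lt hs] using hrs)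
    calc ∑ r ∈ Finset.range m, ‖φ (f^[m * q + r] x) - φ (f^[m * N + (m * q + r) % m] x)‖
        ≤ ∑ r ∈ Finset.range m, (ε / 2 + C * |ξ (m * q + r) - ξ (m * N + r)|) := by
          refine Finset.sum_le_sum fun r hr => ?_
          rw [Nat.mul_add_mod, Nat.mod_eq_of_lt (Finset.mem_range.1 hr)]
          exact hφ _ _
      _ = m * (ε / 2) + C * ∑ r ∈ Finset.range m, |ξ (m * q + r) - ξ (m * N + r)| := by
          rw [Finset.sum_add_distrib, ← Finset.mul_sum]
          simp
      _ ≤ m * (ε / 2) + C * (b - a) := by gcongr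
  · rw [div_lt_iff₀ (by positivity)] at hk
    rw [div_lt_iff₀ hmpos]
    have : ((m : ℕ) : ℝ) = 2 ^ k := by simp [hm]
    rw [this]
    linarith
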